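/- A metric space $(X,d)$ is Gromov hyperbolic if there is $\delta\ge 0$ with $d(x,y)+d(z,w)\le\max\{d(x,z)+d(y,w),\,d(x,w)+d(y,z)\}+2\delta$ for all $x,y,z,w\in X$. It is roughly geodesic if there is $k\ge 0$ such that any $x,x'\in X$ are joined by a map $\gamma:[\alpha,\omega]\to X$, $\alpha\le\omega$, with $\gamma(\alpha)=x$, $\gamma(\omega)=x'$ and $\bigl|\,d(\gamma(s),\gamma(t))-|s-t|\,\bigr|\le k$ for all $s,t\in[\alpha,\omega]$. Given a base point $p\in X$, put $(x\cdot y)_p=\frac12\bigl(d(x,p)+d(y,p)-d(x,y)\bigr)$. A sequence $(x^i)$ in $X$ converges to infinity if $\liminf_{i,j\to\infty}(x^i\cdot x^j)_p=\infty$. For a Gromov hyperbolic space $X$, the boundary at infinity $\partial_\infty X$ is the set of classes $[(x^i)]$ of sequences converging to infinity, where $(x^i)\sim(y^i)$ if $\liminf_{i,j\to\infty}(x^i\cdot y^j)_p=\infty$. For $v\in\partial_\infty X$ and $r>0$ let $U(v,r)$ be the set of those $w\in\partial_\infty X$ for which there are sequences with $[(x^i)]=v$, $[(y^i)]=w$ and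 $\liminf_{i,j\to\infty}(x^i\cdot y^j)_p>r$. The topology of $\partial_\infty X$ is the one in which a set $O$ is open if and only if for every $v\in O$ there is $r>0$ with $U(v,r)\subset O$. **Theorem.** Let $(X_1,d_1)$ and $(X_2,d_2)$ be roughly geodesic, Gromov hyperbolic metric spaces and $z_i\in X_i$. For $\Delta\ge 0$ let $$Y_\Delta=\{(x_1,x_2)\in X_1\times X_2 : |d_1(x_1,z_1)-d_2(x_2,z_2)|\le\Delta\}$$ with the restriction of the metric $d_m\bigl((x_1,x_2),(x_1',x_2')\bigr)=\max\{d_1(x_1,x_1'),d_2(x_2,x_2')\}$. Then there is $\tilde\Delta\ge 0$ such that for every $\Delta\ge\tilde\Delta$ the space $(Y_\Delta,d_m)$ is roughly geodesic and Gromov hyperbolic, and, for all choices of the base points used to define the three boundaries, there is a homeomorphism $\partial_\infty Y_\Delta\to\partial_\infty X_1\times\partial_\infty X_2$ which sends the class $[((x_1^i,x_2^i))_i]$ of each sequence in $Y_\Delta$ converging to infinity to $\bigl([(x_1^i)_i],[(x_2^i)_i]\bigr)$ (in particular, $(x_1^i)_i$ and $(x_2^i)_i$ converge to infinity). -/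

import Mathlib

open Filter

namespace GromovHyp

/-- The four-point condition with constant `δ`. -/
def IsDeltaHyperbolic (X : Type*) [MetricSpace X] (δ : ℝ) : Prop :=
  ∀ x y z w : X,
    dist x y + dist z w ≤ max (dist x z + dist y w) (dist x w + dist y z) + 2 * δ

/-- Gromov hyperbolicity of a metric space. -/
def IsGromovHyperbolic (X : Type*) [MetricSpace X] : Prop :=
  ∃ δ : ℝ, 0 ≤ δ ∧ IsDeltaHyperbolic X δ

/-- `γ`, restricted to the interval `[a, b]`, is a `k`-rough geodesic connecting `x` to `x'`:
a `k`-rough-isometric embedding of `[a, b]` with these end points. -/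
def IsRoughGeodesic {X : Type*} [MetricSpace X] (k : ℝ) (γ : ℝ → X) (a b : ℝ) (x x' : X) : Prop :=
  a ≤ b ∧ γ a = x ∧ γ b = x' ∧
    ∀ s ∈ Set.Icc a b, ∀ t ∈ Set.Icc a b,
      |s - t| - k ≤ dist (γ s) (γ t) ∧ dist (γ s) (γ t) ≤ |s - t| + k

/-- A metric space is roughly geodesic if, for one `k ≥ 0`, any two points are connected by a
`k`-rough geodesic. -/
def IsRoughlyGeodesic (X : Type*) [MetricSpace X] : Prop :=
  ∃ k : ℝ, 0 ≤ k ∧ ∀ x x' : X, ∃ (a b : ℝ) (γ : ℝ → X), IsRoughGeodesic k γ a b x x'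

/-- The set `Y_Δ` of pairs whose distances to the base points differ by at most `Δ`. Its metric is
the restriction of the metric of `X₁ × X₂`, which in Mathlib is the maximum metric. -/
def Y {X₁ X₂ : Type*} [MetricSpace X₁] [MetricSpace X₂] (z₁ : X₁) (z₂ : X₂) (Δ : ℝ) :
    Set (X₁ × X₂) :=
  {x | |dist x.1 z₁ - dist x.2 z₂| ≤ Δ}

/-- The Gromov product `(x · y)_z`. -/
noncomputable def gromovProduct {X : Type*} [MetricSpace X] (z x y : X) : ℝ :=
  (dist x z + dist y z - dist x y) / 2

/-- `liminf_{i,j → ∞} (xⁱ · yʲ)_z`, an extended real number. -/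
noncomputable def liminfProduct {X : Type*} [MetricSpace X] (z : X) (x y : ℕ → X) : EReal :=
  liminf (fun p : ℕ × ℕ => ((gromovProduct z (x p.1) (y p.2) : ℝ) : EReal)) atTop

/-- The sequence `x` converges to infinity. -/
def ConvergesToInfinity {X : Type*} [MetricSpace X] (z : X) (x : ℕ → X) : Prop :=
  liminfProduct z x x = ⊤

/-- The relation `x ∼ y` on sequences that converge to infinity. -/
def Asymptotic {X : Type*} [MetricSpace X] (z : X)
    (x y : {x : ℕ → X // ConvergesToInfinity z x}) : Prop :=
  liminfProduct z x.1 y.1 = ⊤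

/-- The boundary at infinity, with base point `z`: classes of sequences that converge to infinity.
In a Gromov hyperbolic space `Asymptotic z` is an equivalence relation
(`asymptotic_equivalence` below), so that the points are its equivalence classes. -/
def Boundary {X : Type*} [MetricSpace X] (z : X) : Type _ :=
  Quot (Asymptotic z)

/-- The point `[x]` of the boundary. -/
def Boundary.mk {X : Type*} [MetricSpace X] (z : X) (x : ℕ → X) (hx : ConvergesToInfinity z x) :
    Boundary z :=
  Quot.mk _ ⟨x, hx⟩

/-- The set `U(v, r)`. -/
def Boundary.U {X : Type*} [MetricSpace X] {z : X} (v : Boundary z) (r : ℝ) : Set (Boundary z) :=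
  {w | ∃ (x y : ℕ → X) (hx : ConvergesToInfinity z x) (hy : ConvergesToInfinity z y),
    Boundary.mk z x hx = v ∧ Boundary.mk z y hy = w ∧ (r : EReal) < liminfProduct z x y}

theorem Boundary.U_anti {X : Type*} [MetricSpace X] {z : X} (v : Boundary z) {r s : ℝ}
    (h : r ≤ s) : Boundary.U v s ⊆ Boundary.U v r := by
  rintro w ⟨x, y, hx, hy, h1, h2, h3⟩
  exact ⟨x, y, hx, hy, h1, h2, lt_of_le_of_lt (EReal.coe_le_coe_iff.2 h) h3⟩

/-- The topology of the boundary in which the sets `U(v, r)`, `r > 0`, generate the neighbourhoods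
of `v`: a set is open if and only if with each of its points `v` it contains some `U(v, r)`. -/
instance {X : Type*} [MetricSpace X] (z : X) : TopologicalSpace (Boundary z) where
  IsOpen O := ∀ v ∈ O, ∃ r : ℝ, 0 < r ∧ Boundary.U v r ⊆ O
  isOpen_univ := fun _ _ => ⟨1, one_pos, Set.subset_univ _⟩
  isOpen_inter := by
    rintro O O' h h' v ⟨hv, hv'⟩
    obtain ⟨r, hr, hU⟩ := h v hv
    obtain ⟨r', hr', hU'⟩ := h' v hv'
    exact ⟨max r r', lt_max_of_lt_left hr, Set.subset_inter
      ((Boundary.U_anti v (le_max_left _ _)).trans hU)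
      ((Boundary.U_anti v (le_max_right _ _)).trans hU')⟩
  isOpen_sUnion := by
    rintro S h v ⟨O, hO, hv⟩
    obtain ⟨r, hr, hU⟩ := h O hO v hv
    exact ⟨r, hr, hU.trans (Set.subset_sUnion_of_mem hO)⟩

theorem liminfProduct_eq_top {X : Type*} [MetricSpace X] (z : X) (x y : ℕ → X) :
    liminfProduct z x y = ⊤ ↔
      ∀ R : ℝ, ∃ N : ℕ, ∀ i ≥ N, ∀ j ≥ N, R < gromovProduct z (x i) (y j) := by
  constructor
  · intro h R
    have h1 : (R : EReal) < liminfProduct z x y := h ▸ EReal.coe_lt_top R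
    obtain ⟨⟨a, b⟩, hab⟩ := eventually_atTop.1 (eventually_lt_of_lt_liminf h1)
    refine ⟨max a b, fun i hi j hj => ?_⟩
    exact EReal.coe_lt_coe_iff.1 (hab (i, j)
      ⟨(le_max_left a b).trans hi, (le_max_right a b).trans hj⟩)
  · intro h
    refine (EReal.eq_top_iff_forall_lt _).2 fun R => ?_
    obtain ⟨N, hN⟩ := h (R + 1)
    refine lt_of_lt_of_le (EReal.coe_lt_coe_iff.2 (lt_add_one R)) ?_
    refine le_liminf_of_le (by isBoundedDefault) (eventually_atTop.2 ⟨(N, N), fun p hp => ?_⟩)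
    exact EReal.coe_le_coe_iff.2 (hN p.1 hp.1 p.2 hp.2).le

/-- In a Gromov hyperbolic space, `∼` is an equivalence relation. -/
theorem asymptotic_equivalence {X : Type*} [MetricSpace X] (h : IsGromovHyperbolic X) (z : X) :
    Equivalence (Asymptotic z) := by
  obtain ⟨δ, -, hδ⟩ := h
  refine ⟨fun x => x.2, fun {x y} hxy => ?_, fun {x y w} hxy hyw => ?_⟩
  · refine (liminfProduct_eq_top _ _ _).2 fun R => ?_
    obtain ⟨N, hN⟩ := (liminfProduct_eq_top _ _ _).1 hxy R
    refine ⟨N, fun i hi j hj => ?_⟩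
    have := hN j hj i hi
    simp only [gromovProduct] at this ⊢
    rw [dist_comm (y.1 i) (x.1 j)]
    linarith
  · refine (liminfProduct_eq_top _ _ _).2 fun R => ?_
    obtain ⟨N, hN⟩ := (liminfProduct_eq_top _ _ _).1 hxy (R + δ)
    obtain ⟨M, hM⟩ := (liminfProduct_eq_top _ _ _).1 hyw (R + δ)
    refine ⟨max N M, fun i hi j hj => ?_⟩
    have h1 := hN i ((le_max_left _ _).trans hi) _ (le_max_left N M)
    have h2 := hM _ (le_max_right N M) j ((le_max_right _ _).trans hj)
    have h3 := hδ (x.1 i) (w.1 j) (y.1 (max N M)) z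
    simp only [gromovProduct] at h1 h2 ⊢
    rw [dist_comm (w.1 j) (y.1 (max N M))] at h3
    rcases max_cases (dist (x.1 i) (y.1 (max N M)) + dist (w.1 j) z)
      (dist (x.1 i) z + dist (y.1 (max N M)) (w.1 j)) with h4 | h4 <;>
    · rw [h4.1] at h3
      linarith

end GromovHyp

/-!
Everything is reduced to one estimate. Write `z = (z₁, z₂)` and let `x, y` be points of `Y_Δ`. Since
the two coordinates of a point of `Y_Δ` have the same distance to the base point up to `Δ`, the
Gromov product `(x · y)_z` for the maximum metric agrees with the minimum of `(x₁ · y₁)_{z₁}` and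
`(x₂ · y₂)_{z₂}` up to an additive constant (`Y.exists_abs_gromovProduct_sub_min_le`).

* The inequality `(x · y) ≥ min {(x · w), (w · y)} - δ` at one base point passes to minima, and it
  implies the four-point condition with constant `2 δ`; hence `Y_Δ` is hyperbolic
  (`Y.isGromovHyperbolic`).
* In a hyperbolic space it is enough to have rough geodesics from one base point: from `x` to `x'`
  one follows the radial path from `x` down to the level `(x · x')_z`, where the radial paths of `x`
  and `x'` are still uniformly close, and then goes up to `x'`
  (`isRoughlyGeodesic_of_radial`). In `Y_Δ`, a radial path to `x` is a pair of rough
  geodesics run simultaneously, which stays in `Y_Δ` as soon as `Δ ≥ 2 k`; the bounded remainder of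
  the longer of the two is skipped (`Y.exists_radial`).
* A sequence in `Y_Δ` converges to infinity if and only if both of its coordinates do, and likewise
  for the relation `∼`. This gives a well defined injective map of the boundaries. It is
  surjective because two sequences in the factors can be replaced by equivalent ones of equal
  levels, cutting rough geodesics to the base points at the smaller of the two levels
  (`Y.exists_seq_asymptotic`).
* In a hyperbolic space the sets `U(v, r)` form a neighbourhood basis of `v`
  (`Boundary.nhds_hasBasis`), and the map on boundaries carries these bases to each other
  up to a shift of `r`.
-/

open Filter Topology

namespace GromovHyp

/-! ### Gromov products and the four-point condition -/

section Product

variable {X : Type*} [MetricSpace X]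

theorem gromovProduct_comm (z x y : X) : gromovProduct z x y = gromovProduct z y x := by
  simp only [gromovProduct, dist_comm x y]
  ring

theorem IsDeltaHyperbolic.min_sub_le {δ : ℝ} (h : IsDeltaHyperbolic X δ) (z x w y : X) :
    min (gromovProduct z x w) (gromovProduct z w y) - δ ≤ gromovProduct z x y := by
  have h3 := h x y w z
  rw [dist_comm y w] at h3
  simp only [gromovProduct]
  rcases max_cases (dist x w + dist y z) (dist x z + dist w y) with h4 | h4 <;>
  rcases min_cases ((dist x z + dist w z - dist x w) / 2) ((dist w z + dist y z - dist w y) / 2)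
    with h5 | h5 <;>
  · rw [h4.1] at h3
    rw [h5.1]
    linarith [h4.2, h5.2]

theorem IsDeltaHyperbolic.lt_gromovProduct {δ : ℝ} (h : IsDeltaHyperbolic X δ) {z x w y : X}
    {r : ℝ} (h1 : r + δ < gromovProduct z x w) (h2 : r + δ < gromovProduct z w y) :
    r < gromovProduct z x y := by
  linarith [h.min_sub_le z x w y, lt_min h1 h2]

/-- The inequality for Gromov products at a single base point implies the four-point condition.
Among the products `(x · u), (y · w), (x · w), (y · u)` the largest one may be assumed to be any
given one by symmetry; leaving it out of the two minima gives the claim. -/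
theorem isDeltaHyperbolic_of_basepoint {δ : ℝ} (z : X)
    (h : ∀ x w y : X, min (gromovProduct z x w) (gromovProduct z w y) - δ ≤ gromovProduct z x y) :
    IsDeltaHyperbolic X (2 * δ) := by
  intro x y u w
  have h1 := h x u y
  have h2 := h x w y
  have h3 := h u x w
  have h4 := h u y w
  rw [gromovProduct_comm z u y] at h1 h4
  rw [gromovProduct_comm z w y] at h2
  rw [gromovProduct_comm z u x] at h3
  simp only [gromovProduct] at h1 h2 h3 h4
  by_contra! hc
  have hc1 := (max_lt_iff.1 (lt_sub_iff_add_lt.2 hc)).1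
  have hc2 := (max_lt_iff.1 (lt_sub_iff_add_lt.2 hc)).2
  rw [sub_le_iff_le_add, min_le_iff] at h1 h2 h3 h4
  rcases h1 with h1 | h1 <;> rcases h2 with h2 | h2 <;> rcases h3 with h3 | h3 <;>
    rcases h4 with h4 | h4 <;> linarith

theorem gromovProduct_le_dist_left (z x y : X) : gromovProduct z x y ≤ dist x z := by
  simp only [gromovProduct]
  linarith [dist_triangle_left y z x]

theorem gromovProduct_nonneg (z x y : X) : 0 ≤ gromovProduct z x y := by
  simp only [gromovProduct]
  linarith [dist_triangle_right x y z]

theorem abs_gromovProduct_sub_le (p q x y : X) :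
    |gromovProduct p x y - gromovProduct q x y| ≤ dist p q := by
  simp only [gromovProduct]
  have a1 := dist_triangle x p q
  have a2 := dist_triangle_right x p q
  have a3 := dist_triangle y p q
  have a4 := dist_triangle_right y p q
  exact abs_sub_le_iff.2 ⟨by linarith, by linarith⟩

end Product

/-! ### Rough geodesics in hyperbolic spaces -/

section Geodesic

variable {X : Type*} [MetricSpace X]

theorem IsRoughGeodesic.mono {k l : ℝ} (hkl : k ≤ l) {γ : ℝ → X} {a b : ℝ} {x x' : X}
    (h : IsRoughGeodesic k γ a b x x') : IsRoughGeodesic l γ a b x x' := by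
  obtain ⟨hab, ha, hb, h⟩ := h
  refine ⟨hab, ha, hb, fun s hs t ht => ?_⟩
  obtain ⟨h1, h2⟩ := h s hs t ht
  constructor <;> linarith

theorem IsRoughGeodesic.shift {k : ℝ} {γ : ℝ → X} {a b : ℝ} {x x' : X}
    (h : IsRoughGeodesic k γ a b x x') :
    IsRoughGeodesic k (fun t => γ (a + t)) 0 (b - a) x x' := by
  obtain ⟨hab, ha, hb, h⟩ := h
  refine ⟨by linarith, by simpa using ha, by simpa using hb, fun s hs t ht => ?_⟩
  have := h (a + s) ⟨by linarith [hs.1], by linarith [hs.2]⟩ (a + t)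
    ⟨by linarith [ht.1], by linarith [ht.2]⟩
  simpa using this

theorem IsRoughlyGeodesic.exists_common_const {X' : Type*} [MetricSpace X']
    (h : IsRoughlyGeodesic X) (h' : IsRoughlyGeodesic X') : ∃ k : ℝ, 0 ≤ k ∧
      (∀ x x' : X, ∃ (b : ℝ) (γ : ℝ → X), IsRoughGeodesic k γ 0 b x x') ∧
      ∀ x x' : X', ∃ (b : ℝ) (γ : ℝ → X'), IsRoughGeodesic k γ 0 b x x' := by
  obtain ⟨k, hk, h⟩ := h
  obtain ⟨k', -, h'⟩ := h'
  refine ⟨max k k', le_max_of_le_left hk, fun x x' => ?_, fun x x' => ?_⟩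
  · obtain ⟨a, b, γ, hγ⟩ := h x x'
    exact ⟨_, _, (hγ.mono (le_max_left k k')).shift⟩
  · obtain ⟨a, b, γ, hγ⟩ := h' x x'
    exact ⟨_, _, (hγ.mono (le_max_right k k')).shift⟩

/-- A coarsely `1`-Lipschitz path whose length exceeds the distance of its end points by a bounded
amount is a rough geodesic: the lower bound is the triangle inequality for the end points. -/
theorem isRoughGeodesic_of_dist_le {C L : ℝ} (hC : 0 ≤ C) (hL : 0 ≤ L) {η : ℝ → X} {x x' : X}
    (h0 : η 0 = x) (h1 : η L = x')
    (h : ∀ s t, 0 ≤ s → s ≤ t → t ≤ L → dist (η s) (η t) ≤ t - s + C)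
    (hd : L ≤ dist x x' + C) : IsRoughGeodesic (3 * C) η 0 L x x' := by
  have key : ∀ s t, 0 ≤ s → s ≤ t → t ≤ L → t - s - 3 * C ≤ dist (η s) (η t) := by
    intro s t hs hst ht
    have e1 := h 0 s le_rfl hs (hst.trans ht)
    have e2 := h t L (hs.trans hst) ht le_rfl
    rw [h0] at e1
    rw [h1] at e2
    linarith [dist_triangle4 x (η s) (η t) x']
  refine ⟨hL, h0, h1, fun s hs t ht => ?_⟩
  rcases le_total s t with hst | hst
  · rw [abs_sub_comm, abs_of_nonneg (sub_nonneg.2 hst)]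
    exact ⟨key s t hs.1 hst ht.2, by linarith [h s t hs.1 hst ht.2]⟩
  · rw [abs_of_nonneg (sub_nonneg.2 hst), dist_comm]
    exact ⟨key t s ht.1 hst hs.2, by linarith [h t s ht.1 hst hs.2]⟩

theorem IsRoughGeodesic.dist_le {k : ℝ} {γ : ℝ → X} {b s t : ℝ} {x x' : X}
    (h : IsRoughGeodesic k γ 0 b x x') (hs : 0 ≤ s) (hst : s ≤ t) (ht : t ≤ b) :
    dist (γ s) (γ t) ≤ t - s + k := by
  have := (h.2.2.2 s ⟨hs, hst.trans ht⟩ t ⟨hs.trans hst, ht⟩).2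
  rwa [abs_sub_comm, abs_of_nonneg (sub_nonneg.2 hst)] at this

theorem IsRoughGeodesic.le_dist {k : ℝ} {γ : ℝ → X} {b s t : ℝ} {x x' : X}
    (h : IsRoughGeodesic k γ 0 b x x') (hs : 0 ≤ s) (hst : s ≤ t) (ht : t ≤ b) :
    t - s - k ≤ dist (γ s) (γ t) := by
  have := (h.2.2.2 s ⟨hs, hst.trans ht⟩ t ⟨hs.trans hst, ht⟩).1
  rwa [abs_sub_comm, abs_of_nonneg (sub_nonneg.2 hst)] at this

theorem IsRoughGeodesic.abs_dist_sub_le {k : ℝ} {γ : ℝ → X} {b s : ℝ} {z x : X}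
    (h : IsRoughGeodesic k γ 0 b z x) (hs : 0 ≤ s) (hsb : s ≤ b) : |dist (γ s) z - s| ≤ k := by
  have h1 := h.dist_le le_rfl hs hsb
  have h2 := h.le_dist le_rfl hs hsb
  rw [h.2.1, dist_comm] at h1 h2
  exact abs_sub_le_iff.2 ⟨by linarith, by linarith⟩

theorem IsRoughGeodesic.abs_dist_end_sub_le {k : ℝ} {γ : ℝ → X} {b : ℝ} {z x : X}
    (h : IsRoughGeodesic k γ 0 b z x) : |dist x z - b| ≤ k := by
  have := h.abs_dist_sub_le h.1 le_rfl
  rwa [h.2.2.1] at this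

/-- A point at parameter `s` of a rough geodesic from `z` to `x` has Gromov product with `x`
at least `s`, up to a constant. -/
theorem IsRoughGeodesic.le_gromovProduct {k : ℝ} {γ : ℝ → X} {b s : ℝ} {z x : X}
    (h : IsRoughGeodesic k γ 0 b z x) (hs : 0 ≤ s) (hsb : s ≤ b) :
    s - 2 * k ≤ gromovProduct z (γ s) x := by
  have h1 := (abs_sub_le_iff.1 (h.abs_dist_sub_le hs hsb)).2
  have h2 := (abs_sub_le_iff.1 h.abs_dist_end_sub_le).2
  have h3 := h.dist_le hs hsb le_rfl
  rw [h.2.2.1] at h3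
  have hk : 0 ≤ k := (abs_nonneg _).trans h.abs_dist_end_sub_le
  simp only [gromovProduct]
  linarith

/-- Rough geodesics from `z` to `x` and to `x'` are uniformly close up to the parameter
`(x · x')_z`. -/
theorem IsDeltaHyperbolic.dist_radial_le {δ k : ℝ} (h : IsDeltaHyperbolic X δ) {z x x' : X}
    {γ γ' : ℝ → X} {b b' m : ℝ} (hγ : IsRoughGeodesic k γ 0 b z x)
    (hγ' : IsRoughGeodesic k γ' 0 b' z x') (hm : 0 ≤ m) (hmb : m ≤ b) (hmb' : m ≤ b')
    (hmx : m ≤ gromovProduct z x x') : dist (γ m) (γ' m) ≤ 6 * k + 4 * |δ| := by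
  have hk : 0 ≤ k := (abs_nonneg _).trans hγ.abs_dist_end_sub_le
  have e1 := hγ.le_gromovProduct hm hmb
  have e2 := hγ'.le_gromovProduct hm hmb'
  rw [gromovProduct_comm] at e2
  have e3 := h.min_sub_le z (γ m) x x'
  have e4 := h.min_sub_le z (γ m) x' (γ' m)
  have f1 : m - 2 * k ≤ min (gromovProduct z (γ m) x) (gromovProduct z x x') :=
    le_min e1 (by linarith)
  have f2 : m - 2 * k - |δ| ≤ min (gromovProduct z (γ m) x') (gromovProduct z x' (γ' m)) :=
    le_min (by linarith [le_abs_self δ]) (by linarith [abs_nonneg δ])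
  have f3 : m - 2 * k - 2 * |δ| ≤ gromovProduct z (γ m) (γ' m) := by linarith [le_abs_self δ]
  have g1 := (abs_sub_le_iff.1 (hγ.abs_dist_sub_le hm hmb)).1
  have g2 := (abs_sub_le_iff.1 (hγ'.abs_dist_sub_le hm hmb')).1
  simp only [gromovProduct] at f3
  linarith

/-- A hyperbolic space in which all points are joined to one base point by rough geodesics is
roughly geodesic. -/
theorem isRoughlyGeodesic_of_radial (h : IsGromovHyperbolic X) (z : X) {k : ℝ} (hk : 0 ≤ k)
    (hz : ∀ x : X, ∃ (b : ℝ) (γ : ℝ → X), IsRoughGeodesic k γ 0 b z x) :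
    IsRoughlyGeodesic X := by
  obtain ⟨δ, hδ, h⟩ := h
  refine ⟨3 * (8 * k + 4 * δ + 1), by positivity, fun x x' => ?_⟩
  obtain ⟨b, γ, hγ⟩ := hz x
  obtain ⟨b', γ', hγ'⟩ := hz x'
  have hb := hγ.1
  have hb' := hγ'.1
  -- The turning level is the Gromov product, cut off so that both paths are defined there.
  obtain ⟨m, hm, hmb, hmb', hmx, hmk⟩ : ∃ m : ℝ, 0 ≤ m ∧ m ≤ b ∧ m ≤ b' ∧
      m ≤ gromovProduct z x x' ∧ gromovProduct z x x' - k ≤ m := by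
    refine ⟨min (gromovProduct z x x') (min b b'),
      le_min (gromovProduct_nonneg z x x') (le_min hb hb'),
      (min_le_right _ _).trans (min_le_left _ _), (min_le_right _ _).trans (min_le_right _ _),
      min_le_left _ _, le_min (by linarith) (le_min ?_ ?_)⟩
    · linarith [gromovProduct_le_dist_left z x x', (abs_sub_le_iff.1 hγ.abs_dist_end_sub_le).1]
    · rw [gromovProduct_comm]
      linarith [gromovProduct_le_dist_left z x' x, (abs_sub_le_iff.1 hγ'.abs_dist_end_sub_le).1]
  have hE := h.dist_radial_le hγ hγ' hm hmb hmb' hmx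
  rw [abs_of_nonneg hδ] at hE
  -- The additional unit of time between the two legs makes sure that the second one is not
  -- empty, so that the path ends at `x'` even if `m = b'`.
  refine ⟨0, (b - m) + 1 + (b' - m),
    fun t => if t ≤ b - m then γ (b - t) else γ' (m + max 0 (t - (b - m) - 1)), ?_⟩
  refine isRoughGeodesic_of_dist_le (by positivity) (by linarith) ?_ ?_ ?_ ?_
  · simp [hmb, hγ.2.2.1]
  · rw [if_neg (by linarith), max_eq_right (by linarith), ← hγ'.2.2.1]
    congr 1
    ring
  · intro s t hs hst ht
    by_cases h1 : t ≤ b - m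
    · rw [if_pos h1, if_pos (hst.trans h1), dist_comm]
      have := hγ.dist_le (s := b - t) (t := b - s) (by linarith) (by linarith) (by linarith)
      linarith
    · have e0 : max 0 (t - (b - m) - 1) ≤ t - (b - m) := max_le (by linarith) (by linarith)
      have e1 : max 0 (t - (b - m) - 1) ≤ b' - m := max_le (by linarith) (by linarith)
      have e2 : 0 ≤ max 0 (t - (b - m) - 1) := le_max_left _ _
      rw [if_neg h1]
      by_cases h2 : s ≤ b - m
      · rw [if_pos h2]
        have f1 := hγ.dist_le (s := m) (t := b - s) hm (by linarith) (by linarith)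
        have f2 := hγ'.dist_le (s := m) (t := m + max 0 (t - (b - m) - 1)) hm (by linarith)
          (by linarith)
        rw [dist_comm] at f1
        linarith [dist_triangle4 (γ (b - s)) (γ m) (γ' m) (γ' (m + max 0 (t - (b - m) - 1)))]
      · rw [if_neg h2]
        have e3 : 0 ≤ max 0 (s - (b - m) - 1) := le_max_left _ _
        have e4 : max 0 (s - (b - m) - 1) ≤ max 0 (t - (b - m) - 1) :=
          max_le_max le_rfl (by linarith)
        have e5 : max 0 (t - (b - m) - 1) ≤ max 0 (s - (b - m) - 1) + (t - s) :=
          max_le (by linarith) (by linarith [le_max_right 0 (s - (b - m) - 1)])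
        have := hγ'.dist_le (s := m + max 0 (s - (b - m) - 1))
          (t := m + max 0 (t - (b - m) - 1)) (by linarith) (by linarith) (by linarith)
        linarith
  · have e1 := (abs_sub_le_iff.1 hγ.abs_dist_end_sub_le).2
    have e2 := (abs_sub_le_iff.1 hγ'.abs_dist_end_sub_le).2
    simp only [gromovProduct] at hmk
    linarith

end Geodesic

/-! ### Sequences and the topology of the boundary -/

section Boundary

variable {X : Type*} [MetricSpace X]

theorem exists_lt_of_lt_liminfProduct {z : X} {x y : ℕ → X} {r : ℝ}
    (h : (r : EReal) < liminfProduct z x y) :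
    ∃ N : ℕ, ∀ i ≥ N, ∀ j ≥ N, r < gromovProduct z (x i) (y j) := by
  obtain ⟨⟨a, b⟩, hab⟩ := eventually_atTop.1 (eventually_lt_of_lt_liminf h)
  exact ⟨max a b, fun i hi j hj => EReal.coe_lt_coe_iff.1 (hab (i, j)
    ⟨(le_max_left a b).trans hi, (le_max_right a b).trans hj⟩)⟩

theorem lt_liminfProduct {z : X} {x y : ℕ → X} {r s : ℝ} (hrs : r < s)
    (h : ∃ N : ℕ, ∀ i ≥ N, ∀ j ≥ N, s < gromovProduct z (x i) (y j)) :
    (r : EReal) < liminfProduct z x y := by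
  obtain ⟨N, hN⟩ := h
  refine lt_of_lt_of_le (EReal.coe_lt_coe_iff.2 hrs) ?_
  refine le_liminf_of_le (by isBoundedDefault) (eventually_atTop.2 ⟨(N, N), fun p hp => ?_⟩)
  exact EReal.coe_le_coe_iff.2 (hN p.1 hp.1 p.2 hp.2).le

theorem liminfProduct_eq_top_comm {z : X} {x y : ℕ → X} (h : liminfProduct z x y = ⊤) :
    liminfProduct z y x = ⊤ := by
  rw [liminfProduct_eq_top] at h ⊢
  intro R
  obtain ⟨N, hN⟩ := h R
  exact ⟨N, fun i hi j hj => gromovProduct_comm z (x j) (y i) ▸ hN j hj i hi⟩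

theorem liminfProduct_eq_top_trans (h : IsGromovHyperbolic X) {z : X} {x y w : ℕ → X}
    (hxy : liminfProduct z x y = ⊤) (hyw : liminfProduct z y w = ⊤) :
    liminfProduct z x w = ⊤ := by
  obtain ⟨δ, -, hδ⟩ := h
  refine (liminfProduct_eq_top _ _ _).2 fun R => ?_
  obtain ⟨N, hN⟩ := (liminfProduct_eq_top _ _ _).1 hxy (R + δ)
  obtain ⟨M, hM⟩ := (liminfProduct_eq_top _ _ _).1 hyw (R + δ)
  exact ⟨max N M, fun i hi j hj => hδ.lt_gromovProduct
    (hN i ((le_max_left _ _).trans hi) _ (le_max_left N M))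
    (hM _ (le_max_right N M) j ((le_max_right _ _).trans hj))⟩

theorem Boundary.mk_eq_mk_iff (h : IsGromovHyperbolic X) {z : X} {x y : ℕ → X}
    (hx : ConvergesToInfinity z x) (hy : ConvergesToInfinity z y) :
    Boundary.mk z x hx = Boundary.mk z y hy ↔ liminfProduct z x y = ⊤ := by
  constructor
  · intro hxy
    have : Relation.EqvGen (Asymptotic z) ⟨x, hx⟩ ⟨y, hy⟩ := Quot.eqvGen_exact hxy
    have hxy' : Asymptotic z ⟨x, hx⟩ ⟨y, hy⟩ := (asymptotic_equivalence h z).eqvGen_iff.1 this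
    exact hxy'
  · intro hxy
    exact Quot.sound hxy

theorem Boundary.exists_mk {z : X} (v : Boundary z) :
    ∃ (x : ℕ → X) (hx : ConvergesToInfinity z x), v = Boundary.mk z x hx := by
  induction v using Quot.ind with
  | mk x => exact ⟨x.1, x.2, rfl⟩

theorem Boundary.mk_mem_U {z : X} {x y : ℕ → X} (hx : ConvergesToInfinity z x)
    (hy : ConvergesToInfinity z y) {r s : ℝ} (hrs : r < s)
    (h : ∃ N : ℕ, ∀ i ≥ N, ∀ j ≥ N, s < gromovProduct z (x i) (y j)) :
    Boundary.mk z y hy ∈ Boundary.U (Boundary.mk z x hx) r :=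
  ⟨x, y, hx, hy, rfl, rfl, lt_liminfProduct hrs h⟩

/-- Up to a loss of `2 δ`, membership in `U(v, r)` may be tested on arbitrary representatives. -/
theorem Boundary.exists_lt_of_mk_mem_U {δ : ℝ} (h : IsDeltaHyperbolic X δ) (hδ : 0 ≤ δ) {z : X}
    {x y : ℕ → X} {hx : ConvergesToInfinity z x} {hy : ConvergesToInfinity z y} {r : ℝ}
    (hU : Boundary.mk z y hy ∈ Boundary.U (Boundary.mk z x hx) (r + 2 * δ)) :
    ∃ N : ℕ, ∀ i ≥ N, ∀ j ≥ N, r < gromovProduct z (x i) (y j) := by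
  obtain ⟨x', y', hx', hy', ex, ey, hr⟩ := hU
  rw [Boundary.mk_eq_mk_iff ⟨δ, hδ, h⟩] at ex ey
  obtain ⟨N, hN⟩ := exists_lt_of_lt_liminfProduct hr
  obtain ⟨A, hA⟩ := (liminfProduct_eq_top _ _ _).1 (liminfProduct_eq_top_comm ex) (r + 2 * δ)
  obtain ⟨B, hB⟩ := (liminfProduct_eq_top _ _ _).1 ey (r + 2 * δ)
  refine ⟨max N (max A B), fun i hi j hj => ?_⟩
  simp only [ge_iff_le, max_le_iff] at hi hj
  refine h.lt_gromovProduct (w := y' j) (h.lt_gromovProduct (w := x' i) ?_ ?_) ?_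
  · linarith [hA i hi.2.1 i hi.2.1]
  · linarith [hN i hi.1 j hj.1]
  · linarith [hB j hj.2.2 j hj.2.2]

theorem Boundary.self_mem_U {z : X} (v : Boundary z) (r : ℝ) : v ∈ Boundary.U v r := by
  obtain ⟨x, hx, rfl⟩ := v.exists_mk
  exact Boundary.mk_mem_U hx hx (lt_add_one r) ((liminfProduct_eq_top _ _ _).1 hx (r + 1))

theorem Boundary.U_subset_U {δ : ℝ} (h : IsDeltaHyperbolic X δ) (hδ : 0 ≤ δ) {z : X}
    {v w : Boundary z} {r : ℝ} (hw : w ∈ Boundary.U v (r + 1 + δ + 2 * δ)) :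
    Boundary.U w (r + 1 + δ + 2 * δ) ⊆ Boundary.U v r := by
  intro u hu
  obtain ⟨x, hx, rfl⟩ := v.exists_mk
  obtain ⟨y, hy, rfl⟩ := w.exists_mk
  obtain ⟨t, ht, rfl⟩ := u.exists_mk
  obtain ⟨N, hN⟩ := Boundary.exists_lt_of_mk_mem_U h hδ hw
  obtain ⟨M, hM⟩ := Boundary.exists_lt_of_mk_mem_U h hδ hu
  exact Boundary.mk_mem_U hx ht (lt_add_one r) ⟨max N M, fun i hi j hj =>
    h.lt_gromovProduct (hN i ((le_max_left _ _).trans hi) _ (le_max_left N M))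
      (hM _ (le_max_right N M) j ((le_max_right _ _).trans hj))⟩

/-- In a hyperbolic space the sets `U(v, r)` are neighbourhoods of `v`, although they need not be
open: the points `w` with `U(w, s) ⊆ U(v, r)` for some `s` form an open set. -/
theorem Boundary.U_mem_nhds (h : IsGromovHyperbolic X) {z : X} (v : Boundary z) {r : ℝ}
    (hr : 0 < r) : Boundary.U v r ∈ 𝓝 v := by
  obtain ⟨δ, hδ, h⟩ := h
  refine mem_nhds_iff.2 ⟨{w | ∃ s : ℝ, 0 < s ∧ Boundary.U w s ⊆ Boundary.U v r}, ?_, ?_,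
    ⟨r, hr, subset_rfl⟩⟩
  · rintro w ⟨s, -, hs⟩
    exact hs (w.self_mem_U s)
  · rintro w ⟨s, hs, hsU⟩
    refine ⟨s + 1 + δ + 2 * δ, by positivity, fun w' hw' => ?_⟩
    exact ⟨s + 1 + δ + 2 * δ, by positivity, (Boundary.U_subset_U h hδ hw').trans hsU⟩

theorem Boundary.nhds_hasBasis (h : IsGromovHyperbolic X) {z : X} (v : Boundary z) :
    (𝓝 v).HasBasis (fun r : ℝ => 0 < r) (Boundary.U v) := by
  refine ⟨fun s => ⟨fun hs => ?_, fun ⟨r, hr, hs⟩ => mem_of_superset (v.U_mem_nhds h hr) hs⟩⟩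
  obtain ⟨O, hOs, hO, hv⟩ := mem_nhds_iff.1 hs
  obtain ⟨r, hr, hU⟩ := hO v hv
  exact ⟨r, hr, hU.trans hOs⟩

end Boundary

/-! ### The metric of `Y_Δ` -/

section Fibre

variable {X₁ X₂ : Type*} [MetricSpace X₁] [MetricSpace X₂] {z₁ : X₁} {z₂ : X₂} {Δ : ℝ}

theorem Y.dist_eq (x y : Y z₁ z₂ Δ) :
    dist x y = max (dist x.1.1 y.1.1) (dist x.1.2 y.1.2) := rfl

theorem Y.exists_abs_dist_sub_le (p : Y z₁ z₂ Δ) (p₁ : X₁) (p₂ : X₂) :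
    ∃ K : ℝ, ∀ x : Y z₁ z₂ Δ,
      |dist x p - dist x.1.1 p₁| ≤ K ∧ |dist x p - dist x.1.2 p₂| ≤ K := by
  refine ⟨Δ + dist p.1.1 z₁ + dist p.1.2 z₂ + dist p₁ z₁ + dist p₂ z₂, fun x => ?_⟩
  obtain ⟨h1, h2⟩ := abs_sub_le_iff.1 (show |dist x.1.1 z₁ - dist x.1.2 z₂| ≤ Δ from x.2)
  have a1 := dist_triangle x.1.1 p.1.1 z₁
  have a2 := dist_triangle_right x.1.1 p.1.1 z₁
  have a3 := dist_triangle x.1.1 p₁ z₁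
  have a4 := dist_triangle_right x.1.1 p₁ z₁
  have b1 := dist_triangle x.1.2 p.1.2 z₂
  have b2 := dist_triangle_right x.1.2 p.1.2 z₂
  have b3 := dist_triangle x.1.2 p₂ z₂
  have b4 := dist_triangle_right x.1.2 p₂ z₂
  have c1 : 0 ≤ dist p.1.1 z₁ := dist_nonneg
  have c2 : 0 ≤ dist p.1.2 z₂ := dist_nonneg
  have c3 : 0 ≤ dist p₁ z₁ := dist_nonneg
  have c4 : 0 ≤ dist p₂ z₂ := dist_nonneg
  rw [Y.dist_eq, abs_sub_le_iff, abs_sub_le_iff]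
  rcases max_cases (dist x.1.1 p.1.1) (dist x.1.2 p.1.2) with ⟨e, e'⟩ | ⟨e, e'⟩ <;> rw [e] <;>
    refine ⟨⟨?_, ?_⟩, ?_, ?_⟩ <;> linarith

/-- The Gromov product of `Y_Δ` is, up to a constant, the minimum of those of the factors. -/
theorem Y.exists_abs_gromovProduct_sub_min_le (p : Y z₁ z₂ Δ) (p₁ : X₁) (p₂ : X₂) :
    ∃ K : ℝ, 0 ≤ K ∧ ∀ x y : Y z₁ z₂ Δ,
      |gromovProduct p x y -
        min (gromovProduct p₁ x.1.1 y.1.1) (gromovProduct p₂ x.1.2 y.1.2)| ≤ K := by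
  obtain ⟨K, hK⟩ := Y.exists_abs_dist_sub_le p p₁ p₂
  refine ⟨K, (abs_nonneg _).trans (hK p).1, fun x y => ?_⟩
  obtain ⟨⟨a1, a2⟩, a3, a4⟩ := (hK x).imp abs_sub_le_iff.1 abs_sub_le_iff.1
  obtain ⟨⟨b1, b2⟩, b3, b4⟩ := (hK y).imp abs_sub_le_iff.1 abs_sub_le_iff.1
  simp only [gromovProduct]
  rw [Y.dist_eq x y, abs_sub_le_iff, sub_le_comm, le_min_iff,
    sub_le_iff_le_add (a := min _ _), min_le_iff]
  rcases max_cases (dist x.1.1 y.1.1) (dist x.1.2 y.1.2) with ⟨e, e'⟩ | ⟨e, e'⟩ <;> rw [e]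
  · exact ⟨⟨by linarith, by linarith⟩, Or.inl (by linarith)⟩
  · exact ⟨⟨by linarith, by linarith⟩, Or.inr (by linarith)⟩

theorem Y.isGromovHyperbolic (h₁ : IsGromovHyperbolic X₁) (h₂ : IsGromovHyperbolic X₂)
    (hΔ : 0 ≤ Δ) : IsGromovHyperbolic (Y z₁ z₂ Δ) := by
  obtain ⟨δ₁, hδ₁, h₁⟩ := h₁
  obtain ⟨δ₂, hδ₂, h₂⟩ := h₂
  let z : Y z₁ z₂ Δ := ⟨(z₁, z₂), by simpa [Y] using hΔ⟩
  obtain ⟨K, hK, h⟩ := Y.exists_abs_gromovProduct_sub_min_le z z₁ z₂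
  refine ⟨2 * (2 * K + max δ₁ δ₂), by positivity, isDeltaHyperbolic_of_basepoint z
    fun x w y => ?_⟩
  have e1 := h₁.min_sub_le z₁ x.1.1 w.1.1 y.1.1
  have e2 := h₂.min_sub_le z₂ x.1.2 w.1.2 y.1.2
  have a1 := (abs_sub_le_iff.1 (h x w)).1
  have a2 := (abs_sub_le_iff.1 (h w y)).1
  have a3 := (abs_sub_le_iff.1 (h x y)).2
  have d1 := le_max_left δ₁ δ₂
  have d2 := le_max_right δ₁ δ₂
  have key : min (gromovProduct z x w) (gromovProduct z w y) - K - max δ₁ δ₂ ≤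
      min (gromovProduct z₁ x.1.1 y.1.1) (gromovProduct z₂ x.1.2 y.1.2) := by
    have m1 := min_le_left (gromovProduct z x w) (gromovProduct z w y)
    have m2 := min_le_right (gromovProduct z x w) (gromovProduct z w y)
    rw [sub_le_comm, le_min_iff] at a1 a2
    refine le_min (le_trans ?_ e1) (le_trans ?_ e2)
    · have := le_min (sub_le_sub_right m1 K |>.trans a1.1) (sub_le_sub_right m2 K |>.trans a2.1)
      linarith
    · have := le_min (sub_le_sub_right m1 K |>.trans a1.2) (sub_le_sub_right m2 K |>.trans a2.2)
      linarith
  linarith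

/-- Two rough geodesics from the base points, run simultaneously, stay in `Y_Δ`. -/
theorem IsRoughGeodesic.prodMk_mem_Y {k : ℝ} {γ₁ : ℝ → X₁} {γ₂ : ℝ → X₂} {b₁ b₂ t : ℝ}
    {x₁ : X₁} {x₂ : X₂} (h₁ : IsRoughGeodesic k γ₁ 0 b₁ z₁ x₁)
    (h₂ : IsRoughGeodesic k γ₂ 0 b₂ z₂ x₂) (hΔ : 2 * k ≤ Δ) (ht : 0 ≤ t) (ht₁ : t ≤ b₁)
    (ht₂ : t ≤ b₂) : (γ₁ t, γ₂ t) ∈ Y z₁ z₂ Δ := by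
  have e1 := abs_sub_le_iff.1 (h₁.abs_dist_sub_le ht ht₁)
  have e2 := abs_sub_le_iff.1 (h₂.abs_dist_sub_le ht ht₂)
  have : |dist (γ₁ t) z₁ - dist (γ₂ t) z₂| ≤ Δ :=
    abs_sub_le_iff.2 ⟨by linarith [e1.1, e2.2], by linarith [e1.2, e2.1]⟩
  exact this

/-- The point `x` is reached from the base point by running rough geodesics of the factors until the
shorter one ends, and then jumping to `x`, which is a bounded distance away. -/
theorem Y.exists_radial {k : ℝ} (hk : 0 ≤ k) (hΔ : 2 * k ≤ Δ) (x : Y z₁ z₂ Δ) {z : Y z₁ z₂ Δ}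
    (hz : z.1 = (z₁, z₂))
    {γ₁ : ℝ → X₁} {γ₂ : ℝ → X₂} {b₁ b₂ : ℝ} (h₁ : IsRoughGeodesic k γ₁ 0 b₁ z₁ x.1.1)
    (h₂ : IsRoughGeodesic k γ₂ 0 b₂ z₂ x.1.2) :
    ∃ (b : ℝ) (γ : ℝ → Y z₁ z₂ Δ), IsRoughGeodesic (3 * (Δ + 3 * k + 1)) γ 0 b z x := by
  have hx := abs_sub_le_iff.1 (show |dist x.1.1 z₁ - dist x.1.2 z₂| ≤ Δ from x.2)
  have e1 := abs_sub_le_iff.1 h₁.abs_dist_end_sub_le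
  have e2 := abs_sub_le_iff.1 h₂.abs_dist_end_sub_le
  obtain ⟨a, ha, ha1, ha2, hb1, hb2⟩ : ∃ a : ℝ, 0 ≤ a ∧ a ≤ b₁ ∧ a ≤ b₂ ∧
      b₁ ≤ a + Δ + 2 * k ∧ b₂ ≤ a + Δ + 2 * k := by
    refine ⟨min b₁ b₂, le_min h₁.1 h₂.1, min_le_left _ _, min_le_right _ _, ?_⟩
    rcases min_cases b₁ b₂ with ⟨e, -⟩ | ⟨e, -⟩ <;> rw [e] <;>
      exact ⟨by linarith [e1.1, e1.2], by linarith [e2.1, e2.2]⟩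
  refine ⟨a + 1, fun t => if ht : 0 ≤ t ∧ t ≤ a then
    ⟨(γ₁ t, γ₂ t), h₁.prodMk_mem_Y h₂ hΔ ht.1 (ht.2.trans ha1) (ht.2.trans ha2)⟩ else x, ?_⟩
  refine isRoughGeodesic_of_dist_le (by linarith) (by linarith) ?_ ?_ ?_ ?_
  · rw [dif_pos ⟨le_rfl, ha⟩]
    exact Subtype.ext ((Prod.ext h₁.2.1 h₂.2.1).trans hz.symm)
  · rw [dif_neg (by rintro ⟨-, h⟩; linarith)]
  · intro s t hs hst ht
    by_cases hta : t ≤ a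
    · rw [dif_pos ⟨hs, hst.trans hta⟩, dif_pos ⟨hs.trans hst, hta⟩, Y.dist_eq]
      refine max_le ?_ ?_
      · linarith [h₁.dist_le hs hst (hta.trans ha1)]
      · linarith [h₂.dist_le hs hst (hta.trans ha2)]
    · rw [dif_neg (c := 0 ≤ t ∧ t ≤ a) (fun h => hta h.2)]
      by_cases hsa : s ≤ a
      · rw [dif_pos ⟨hs, hsa⟩, Y.dist_eq]
        have f1 := h₁.dist_le hs (hsa.trans ha1) le_rfl
        have f2 := h₂.dist_le hs (hsa.trans ha2) le_rfl
        rw [h₁.2.2.1] at f1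
        rw [h₂.2.2.1] at f2
        exact max_le (by linarith) (by linarith)
      · rw [dif_neg (fun h => hsa h.2), dist_self]
        linarith
  · have : dist x.1.1 z₁ ≤ dist z x := by
      rw [dist_comm z x, Y.dist_eq, hz]
      exact le_max_left _ _
    linarith [e1.2]

/-! ### Sequences in `Y_Δ` -/

theorem Y.liminfProduct_eq_top_iff (p : Y z₁ z₂ Δ) (p₁ : X₁) (p₂ : X₂) (x y : ℕ → Y z₁ z₂ Δ) :
    liminfProduct p x y = ⊤ ↔
      liminfProduct p₁ (fun i => (x i).1.1) (fun i => (y i).1.1) = ⊤ ∧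
      liminfProduct p₂ (fun i => (x i).1.2) (fun i => (y i).1.2) = ⊤ := by
  obtain ⟨K, -, hK⟩ := Y.exists_abs_gromovProduct_sub_min_le p p₁ p₂
  simp only [liminfProduct_eq_top]
  refine ⟨fun h => ?_, fun ⟨h₁, h₂⟩ R => ?_⟩
  · constructor <;> intro R <;> obtain ⟨N, hN⟩ := h (R + K) <;>
      refine ⟨N, fun i hi j hj => ?_⟩ <;> have e1 := hN i hi j hj <;>
      have e2 := (abs_sub_le_iff.1 (hK (x i) (y j))).1
    · exact lt_of_lt_of_le (by linarith) (min_le_left _ _)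
    · exact lt_of_lt_of_le (by linarith) (min_le_right _ _)
  · obtain ⟨N, hN⟩ := h₁ (R + K)
    obtain ⟨M, hM⟩ := h₂ (R + K)
    refine ⟨max N M, fun i hi j hj => ?_⟩
    have e1 := hN i ((le_max_left _ _).trans hi) j ((le_max_left _ _).trans hj)
    have e2 := hM i ((le_max_right _ _).trans hi) j ((le_max_right _ _).trans hj)
    linarith [lt_min e1 e2, (abs_sub_le_iff.1 (hK (x i) (y j))).2]

/-- If the points `x' i`, as seen from `q`, lie roughly between `q` and `x i` at levels tending to
infinity, then `x'` and `x` are equivalent. -/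
theorem liminfProduct_eq_top_of_diag {X : Type*} [MetricSpace X] (h : IsGromovHyperbolic X)
    {p : X} (q : X) {x x' : ℕ → X} (hx : ConvergesToInfinity p x)
    (hd : Tendsto (fun i => gromovProduct q (x' i) (x i)) atTop atTop) :
    liminfProduct p x' x = ⊤ := by
  obtain ⟨δ, -, hδ⟩ := h
  refine (liminfProduct_eq_top _ _ _).2 fun R => ?_
  obtain ⟨N, hN⟩ := (liminfProduct_eq_top _ _ _).1 hx (R + δ)
  obtain ⟨M, hM⟩ := eventually_atTop.1 (hd.eventually_gt_atTop (R + δ + dist p q))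
  refine ⟨max N M, fun i hi j hj => hδ.lt_gromovProduct (w := x i) ?_
    (hN i ((le_max_left _ _).trans hi) j ((le_max_left _ _).trans hj))⟩
  linarith [hM i ((le_max_right _ _).trans hi),
    (abs_sub_le_iff.1 (abs_gromovProduct_sub_le p q (x' i) (x i))).2]

theorem ConvergesToInfinity.tendsto_dist {X : Type*} [MetricSpace X] {p : X} (q : X) {x : ℕ → X}
    (hx : ConvergesToInfinity p x) : Tendsto (fun i => dist (x i) q) atTop atTop := by
  refine tendsto_atTop.2 fun R => ?_
  obtain ⟨N, hN⟩ := (liminfProduct_eq_top _ _ _).1 hx (R + dist p q)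
  filter_upwards [eventually_ge_atTop N] with i hi
  have := hN i hi i hi
  simp only [gromovProduct, dist_self] at this
  linarith [dist_triangle_right (x i) p q]

/-- Sequences in the factors converging to infinity are equivalent to the coordinates of a sequence
in `Y_Δ`. -/
theorem Y.exists_seq_asymptotic {k : ℝ} (hΔ : 2 * k ≤ Δ)
    (hg₁ : ∀ x x' : X₁, ∃ (b : ℝ) (γ : ℝ → X₁), IsRoughGeodesic k γ 0 b x x')
    (hg₂ : ∀ x x' : X₂, ∃ (b : ℝ) (γ : ℝ → X₂), IsRoughGeodesic k γ 0 b x x')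
    (h₁ : IsGromovHyperbolic X₁) (h₂ : IsGromovHyperbolic X₂)
    {p₁ : X₁} {p₂ : X₂} {x₁ : ℕ → X₁} {x₂ : ℕ → X₂} (hx₁ : ConvergesToInfinity p₁ x₁)
    (hx₂ : ConvergesToInfinity p₂ x₂) :
    ∃ x : ℕ → Y z₁ z₂ Δ, liminfProduct p₁ (fun i => (x i).1.1) x₁ = ⊤ ∧
      liminfProduct p₂ (fun i => (x i).1.2) x₂ = ⊤ := by
  choose b₁ γ₁ hγ₁ using fun i => hg₁ z₁ (x₁ i)
  choose b₂ γ₂ hγ₂ using fun i => hg₂ z₂ (x₂ i)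
  have hb₁ : Tendsto b₁ atTop atTop :=
    tendsto_atTop_mono (fun i => by linarith [(abs_sub_le_iff.1 (hγ₁ i).abs_dist_end_sub_le).1])
      (tendsto_atTop_add_const_right _ (-k) (hx₁.tendsto_dist z₁))
  have hb₂ : Tendsto b₂ atTop atTop :=
    tendsto_atTop_mono (fun i => by linarith [(abs_sub_le_iff.1 (hγ₂ i).abs_dist_end_sub_le).1])
      (tendsto_atTop_add_const_right _ (-k) (hx₂.tendsto_dist z₂))
  have hr : Tendsto (fun i => min (b₁ i) (b₂ i) + -(2 * k)) atTop atTop :=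
    tendsto_atTop_add_const_right _ _ (tendsto_atTop.2 fun R => by
      filter_upwards [hb₁.eventually_ge_atTop R, hb₂.eventually_ge_atTop R] with i e1 e2
      exact le_min e1 e2)
  have h0 : ∀ i, 0 ≤ min (b₁ i) (b₂ i) := fun i => le_min (hγ₁ i).1 (hγ₂ i).1
  refine ⟨fun i => ⟨_, (hγ₁ i).prodMk_mem_Y (hγ₂ i) hΔ (h0 i) (min_le_left _ _)
    (min_le_right _ _)⟩, liminfProduct_eq_top_of_diag h₁ z₁ hx₁ ?_,
    liminfProduct_eq_top_of_diag h₂ z₂ hx₂ ?_⟩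
  · refine tendsto_atTop_mono (fun i => ?_) hr
    linarith [(hγ₁ i).le_gromovProduct (h0 i) (min_le_left _ _)]
  · refine tendsto_atTop_mono (fun i => ?_) hr
    linarith [(hγ₂ i).le_gromovProduct (h0 i) (min_le_right _ _)]

/-! ### The map of the boundaries -/

theorem Y.convergesToInfinity_iff (p : Y z₁ z₂ Δ) (p₁ : X₁) (p₂ : X₂) (x : ℕ → Y z₁ z₂ Δ) :
    ConvergesToInfinity p x ↔ ConvergesToInfinity p₁ (fun i => (x i).1.1) ∧
      ConvergesToInfinity p₂ (fun i => (x i).1.2) :=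
  Y.liminfProduct_eq_top_iff p p₁ p₂ x x

/-- The map `[(x₁, x₂)] ↦ ([x₁], [x₂])` from the boundary of `Y_Δ` to the product of the boundaries
of the factors. -/
def Y.boundaryMap (p : Y z₁ z₂ Δ) (p₁ : X₁) (p₂ : X₂) (v : Boundary p) :
    Boundary p₁ × Boundary p₂ :=
  Quot.lift (fun x => (Boundary.mk p₁ _ ((Y.convergesToInfinity_iff p p₁ p₂ x.1).1 x.2).1,
      Boundary.mk p₂ _ ((Y.convergesToInfinity_iff p p₁ p₂ x.1).1 x.2).2))
    (fun x y hxy => by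
      have h := (Y.liminfProduct_eq_top_iff p p₁ p₂ x.1 y.1).1 hxy
      exact Prod.ext (Quot.sound h.1) (Quot.sound h.2)) v

theorem Y.boundaryMap_mk (p : Y z₁ z₂ Δ) (p₁ : X₁) (p₂ : X₂) {x : ℕ → Y z₁ z₂ Δ}
    (hx : ConvergesToInfinity p x) :
    Y.boundaryMap p p₁ p₂ (Boundary.mk p x hx) =
      (Boundary.mk p₁ _ ((Y.convergesToInfinity_iff p p₁ p₂ x).1 hx).1,
        Boundary.mk p₂ _ ((Y.convergesToInfinity_iff p p₁ p₂ x).1 hx).2) := rfl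

theorem Y.boundaryMap_injective (h₁ : IsGromovHyperbolic X₁) (h₂ : IsGromovHyperbolic X₂)
    (p : Y z₁ z₂ Δ) (p₁ : X₁) (p₂ : X₂) : Function.Injective (Y.boundaryMap p p₁ p₂) := by
  intro v w hvw
  obtain ⟨x, hx, rfl⟩ := v.exists_mk
  obtain ⟨y, hy, rfl⟩ := w.exists_mk
  rw [Y.boundaryMap_mk, Y.boundaryMap_mk, Prod.mk.injEq, Boundary.mk_eq_mk_iff h₁,
    Boundary.mk_eq_mk_iff h₂] at hvw
  exact Quot.sound ((Y.liminfProduct_eq_top_iff p p₁ p₂ x y).2 hvw)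

theorem Y.boundaryMap_surjective {k : ℝ} (hΔ : 2 * k ≤ Δ)
    (hg₁ : ∀ x x' : X₁, ∃ (b : ℝ) (γ : ℝ → X₁), IsRoughGeodesic k γ 0 b x x')
    (hg₂ : ∀ x x' : X₂, ∃ (b : ℝ) (γ : ℝ → X₂), IsRoughGeodesic k γ 0 b x x')
    (h₁ : IsGromovHyperbolic X₁) (h₂ : IsGromovHyperbolic X₂)
    (p : Y z₁ z₂ Δ) (p₁ : X₁) (p₂ : X₂) : Function.Surjective (Y.boundaryMap p p₁ p₂) := by
  rintro ⟨v₁, v₂⟩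
  obtain ⟨x₁, hx₁, rfl⟩ := v₁.exists_mk
  obtain ⟨x₂, hx₂, rfl⟩ := v₂.exists_mk
  obtain ⟨x, e₁, e₂⟩ := Y.exists_seq_asymptotic (z₁ := z₁) (z₂ := z₂) hΔ hg₁ hg₂ h₁ h₂ hx₁ hx₂
  have hx : ConvergesToInfinity p x := (Y.convergesToInfinity_iff p p₁ p₂ x).2
    ⟨liminfProduct_eq_top_trans h₁ e₁ (liminfProduct_eq_top_comm e₁),
      liminfProduct_eq_top_trans h₂ e₂ (liminfProduct_eq_top_comm e₂)⟩
  refine ⟨Boundary.mk p x hx, ?_⟩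
  rw [Y.boundaryMap_mk, Prod.mk.injEq, Boundary.mk_eq_mk_iff h₁, Boundary.mk_eq_mk_iff h₂]
  exact ⟨e₁, e₂⟩

/-- The boundary map carries the bases of neighbourhoods given by the sets `U(v, r)` to each other,
up to a shift of `r`. -/
theorem Y.isInducing_boundaryMap (h₁ : IsGromovHyperbolic X₁) (h₂ : IsGromovHyperbolic X₂)
    (h : IsGromovHyperbolic (Y z₁ z₂ Δ)) (p : Y z₁ z₂ Δ) (p₁ : X₁) (p₂ : X₂) :
    IsInducing (Y.boundaryMap p p₁ p₂) := by
  refine isInducing_iff_nhds.2 fun v => ?_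
  obtain ⟨K, hK0, hK⟩ := Y.exists_abs_gromovProduct_sub_min_le p p₁ p₂
  refine (v.nhds_hasBasis h).ext
    (((Boundary.nhds_hasBasis h₁ _).prod_nhds' (Boundary.nhds_hasBasis h₂ _)).comap _) ?_ ?_
  · intro r hr
    obtain ⟨δ₁, hδ₁, h₁⟩ := h₁
    obtain ⟨δ₂, hδ₂, h₂⟩ := h₂
    refine ⟨(r + 1 + K + 2 * δ₁, r + 1 + K + 2 * δ₂), ⟨by positivity, by positivity⟩,
      fun w hw => ?_⟩
    obtain ⟨x, hx, rfl⟩ := v.exists_mk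
    obtain ⟨y, hy, rfl⟩ := w.exists_mk
    rw [Y.boundaryMap_mk] at hw
    obtain ⟨N, hN⟩ := Boundary.exists_lt_of_mk_mem_U h₁ hδ₁ hw.1
    obtain ⟨M, hM⟩ := Boundary.exists_lt_of_mk_mem_U h₂ hδ₂ hw.2
    refine Boundary.mk_mem_U hx hy (lt_add_one r) ⟨max N M, fun i hi j hj => ?_⟩
    have e1 := hN i ((le_max_left _ _).trans hi) j ((le_max_left _ _).trans hj)
    have e2 := hM i ((le_max_right _ _).trans hi) j ((le_max_right _ _).trans hj)
    linarith [lt_min e1 e2, (abs_sub_le_iff.1 (hK (x i) (y j))).2]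
  · rintro ⟨r₁, r₂⟩ ⟨hr₁, hr₂⟩
    refine ⟨max r₁ r₂ + 1 + K, by positivity, ?_⟩
    rintro w ⟨x, y, hx, hy, rfl, rfl, hr⟩
    obtain ⟨N, hN⟩ := exists_lt_of_lt_liminfProduct hr
    have key : ∀ i ≥ N, ∀ j ≥ N, max r₁ r₂ + 1 <
        min (gromovProduct p₁ (x i).1.1 (y j).1.1) (gromovProduct p₂ (x i).1.2 (y j).1.2) := by
      intro i hi j hj
      linarith [hN i hi j hj, (abs_sub_le_iff.1 (hK (x i) (y j))).1]
    refine ⟨Boundary.mk_mem_U _ _ (lt_add_of_le_of_pos (le_max_left r₁ r₂) one_pos)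
      ⟨N, fun i hi j hj => (lt_min_iff.1 (key i hi j hj)).1⟩,
      Boundary.mk_mem_U _ _ (lt_add_of_le_of_pos (le_max_right r₁ r₂) one_pos)
      ⟨N, fun i hi j hj => (lt_min_iff.1 (key i hi j hj)).2⟩⟩

end Fibre

end GromovHyp

theorem theorem1p2 {X₁ X₂ : Type*} [MetricSpace X₁] [MetricSpace X₂]
    (hg₁ : GromovHyp.IsRoughlyGeodesic X₁) (hg₂ : GromovHyp.IsRoughlyGeodesic X₂)
    (hh₁ : GromovHyp.IsGromovHyperbolic X₁) (hh₂ : GromovHyp.IsGromovHyperbolic X₂)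
    (z₁ : X₁) (z₂ : X₂) :
    ∃ Δ₀ : ℝ, 0 ≤ Δ₀ ∧ ∀ Δ : ℝ, Δ₀ ≤ Δ →
      GromovHyp.IsRoughlyGeodesic (GromovHyp.Y z₁ z₂ Δ) ∧
      GromovHyp.IsGromovHyperbolic (GromovHyp.Y z₁ z₂ Δ) ∧
      -- the boundaries may be formed with arbitrary base points
      ∀ (p : GromovHyp.Y z₁ z₂ Δ) (p₁ : X₁) (p₂ : X₂),
        ∃ φ : GromovHyp.Boundary p ≃ₜ GromovHyp.Boundary p₁ × GromovHyp.Boundary p₂,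
          -- naturality: `φ` sends `[(x₁ⁱ, x₂ⁱ)]` to `([x₁ⁱ], [x₂ⁱ])`
          ∀ (x : ℕ → GromovHyp.Y z₁ z₂ Δ) (hx : GromovHyp.ConvergesToInfinity p x),
            ∃ (h₁ : GromovHyp.ConvergesToInfinity p₁ fun i => (x i).1.1)
              (h₂ : GromovHyp.ConvergesToInfinity p₂ fun i => (x i).1.2),
              φ (GromovHyp.Boundary.mk p x hx) =
                (GromovHyp.Boundary.mk p₁ _ h₁, GromovHyp.Boundary.mk p₂ _ h₂) := by
  obtain ⟨k, hk, hg₁, hg₂⟩ := hg₁.exists_common_const hg₂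
  refine ⟨2 * k, by positivity, fun Δ hΔ => ?_⟩
  have hΔ0 : 0 ≤ Δ := le_trans (by positivity) hΔ
  have hY : GromovHyp.IsGromovHyperbolic (GromovHyp.Y z₁ z₂ Δ) :=
    GromovHyp.Y.isGromovHyperbolic hh₁ hh₂ hΔ0
  refine ⟨?_, hY, fun p p₁ p₂ => ?_⟩
  · refine GromovHyp.isRoughlyGeodesic_of_radial hY
      ⟨(z₁, z₂), by simpa [GromovHyp.Y] using hΔ0⟩ (k := 3 * (Δ + 3 * k + 1)) (by positivity)
      fun x => ?_
    obtain ⟨b₁, γ₁, hγ₁⟩ := hg₁ z₁ x.1.1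
    obtain ⟨b₂, γ₂, hγ₂⟩ := hg₂ z₂ x.1.2
    exact GromovHyp.Y.exists_radial hk hΔ x rfl hγ₁ hγ₂
  · refine ⟨(Equiv.ofBijective _ ⟨GromovHyp.Y.boundaryMap_injective hh₁ hh₂ p p₁ p₂,
      GromovHyp.Y.boundaryMap_surjective hΔ hg₁ hg₂ hh₁ hh₂ p p₁ p₂⟩).toHomeomorphOfIsInducing
      (GromovHyp.Y.isInducing_boundaryMap hh₁ hh₂ hY p p₁ p₂), fun x hx => ?_⟩
    obtain ⟨h₁, h₂⟩ := (GromovHyp.Y.convergesToInfinity_iff p p₁ p₂ x).1 hx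
    exact ⟨h₁, h₂, rfl⟩
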